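/- Let $1 \le k \le n$ be integers and let $\mathbb{Q}[\mathbf{x}_n] = \mathbb{Q}[x_1,\dots,x_n]$, on which the symmetric group $\mathfrak{S}_n$ acts by $\sigma \cdot x_i = x_{\sigma(i)}$. A word $w = w_1 \cdots w_n$ over the positive integers is *packed* if, for every $i \ge 1$, whenever the letter $i+1$ appears in $w$, so does $i$. Let $\mathcal{W}_n$ be the set of packed words of length $n$, and let $\mathcal{W}_{n,k} \subseteq \mathcal{W}_n$ be the set of those in which all of the letters $1,\dots,k$ appear; $\mathfrak{S}_n$ acts on both sets by permuting the positions of the letters. Let $e_d$ be the elementary symmetric polynomial of degree $d$ in $x_1,\dots,x_n$, and let $e_d^{(i)}$ be the one in the variables other than $x_i$, with $e_0^{(i)} = 1$ and $e_d^{(i)} = 0$ for $d<0$. Put $$J_n = \langle x_i^d \, e_{n-r}^{(i)} : 1 \le i \le n,\ 1 \le r \le d \rangle, \qquad J_{n,k} = J_n + \langle e_n, e_{n-1}, \dots, e_{n-k+1} \rangle,$$ $S_n = \mathbb{Q}[\mathbf{x}_n]/J_n$ and $S_{n,k} = \mathbb{Q}[\mathbf{x}_n]/J_{n,k}$. For distinct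 $\alpha_1,\dots,\alpha_n \in \mathbb{Q}$ let $$X_{n,k} = \{(\alpha_{w_1},\dots,\alpha_{w_n}) : w \in \mathcal{W}_{n,k}\} \subseteq \mathbb{Q}^n .$$ For $X \subseteq \mathbb{Q}^n$ let $\mathbf{I}(X) \subseteq \mathbb{Q}[\mathbf{x}_n]$ be the ideal of polynomials vanishing on $X$, and let $\mathbf{T}(X)$ be the ideal generated by the highest degree homogeneous components of the nonzero elements of $\mathbf{I}(X)$. **Theorem.** For every choice of distinct $\alpha_1,\dots,\alpha_n \in \mathbb{Q}$ we have $J_{n,k} = \mathbf{T}(X_{n,k})$. Consequently, $S_{n,k} \cong \mathbb{Q}[\mathcal{W}_{n,k}]$ as ungraded $\mathfrak{S}_n$-modules. In particular, $S_n \cong \mathbb{Q}[\mathcal{W}_n]$ as ungraded $\mathfrak{S}_n$-modules, and $S_n$ is finite-dimensional with $\dim_{\mathbb{Q}} S_n = |\mathcal{W}_n|$. -/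

import Mathlib

open MvPolynomial

noncomputable section

namespace PackedWordQuotient

/-! ### Packed words -/

/-- A word `w = w₁ ⋯ wₙ` over the positive integers is packed if, whenever the letter `i + 1`
appears in it, so does the letter `i`. -/
def IsPacked {n : ℕ} (w : Fin n → ℕ+) : Prop :=
  ∀ i : ℕ+, i + 1 ∈ Set.range w → i ∈ Set.range w

/-- `𝒲ₙ`: packed words of length `n`. -/
def PackedWord (n : ℕ) : Type :=
  {w : Fin n → ℕ+ // IsPacked w}

/-- `𝒲ₙ,ₖ`: packed words of length `n` in which all the letters `1, …, k` appear. -/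
def PackedWordGE (n k : ℕ) : Type :=
  {w : Fin n → ℕ+ // IsPacked w ∧ ∀ i : ℕ+, (i : ℕ) ≤ k → i ∈ Set.range w}

theorem IsPacked.comp_perm {n : ℕ} {w : Fin n → ℕ+} (hw : IsPacked w)
    (σ : Equiv.Perm (Fin n)) : IsPacked (w ∘ σ) := by
  intro i hi
  rw [σ.surjective.range_comp] at hi ⊢
  exact hw i hi

/-- The symmetric group permutes the positions of the letters: the letter in position `j`
moves to position `σ j`. -/
instance (n : ℕ) : MulAction (Equiv.Perm (Fin n)) (PackedWord n) where
  smul σ w := ⟨w.1 ∘ ⇑(σ⁻¹), w.2.comp_perm σ⁻¹⟩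
  one_smul _ := rfl
  mul_smul σ τ w := Subtype.ext (by
    change w.1 ∘ ⇑((σ * τ)⁻¹) = (w.1 ∘ ⇑(τ⁻¹)) ∘ ⇑(σ⁻¹)
    rw [mul_inv_rev]
    rfl)

instance (n k : ℕ) : MulAction (Equiv.Perm (Fin n)) (PackedWordGE n k) where
  smul σ w := ⟨w.1 ∘ ⇑(σ⁻¹), w.2.1.comp_perm σ⁻¹, fun i hi => by
    rw [(σ⁻¹).surjective.range_comp]
    exact w.2.2 i hi⟩
  one_smul _ := rfl
  mul_smul σ τ w := Subtype.ext (by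
    change w.1 ∘ ⇑((σ * τ)⁻¹) = (w.1 ∘ ⇑(τ⁻¹)) ∘ ⇑(σ⁻¹)
    rw [mul_inv_rev]
    rfl)

theorem IsPacked.mem_range_of_le {n : ℕ} {w : Fin n → ℕ+} (hw : IsPacked w) (m : ℕ+) :
    m ∈ Set.range w → ∀ i ≤ m, i ∈ Set.range w := by
  induction m using PNat.recOn with
  | one =>
    intro h i hi
    rwa [le_antisymm hi one_le]
  | succ m ih =>
    intro h i hi
    rcases hi.eq_or_lt with rfl | hlt
    · exact h
    · exact ih (hw m h) i (PNat.lt_add_one_iff.mp hlt)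

/-- The letters of a packed word of length `n` are at most `n`. -/
theorem IsPacked.letter_le {n : ℕ} {w : Fin n → ℕ+} (hw : IsPacked w) (j : Fin n) :
    (w j : ℕ) ≤ n := by
  have hsub : Finset.Icc 1 (w j) ⊆ Finset.univ.image w := by
    intro i hi
    obtain ⟨a, ha⟩ := hw.mem_range_of_le (w j) ⟨j, rfl⟩ i (Finset.mem_Icc.mp hi).2
    exact Finset.mem_image.mpr ⟨a, Finset.mem_univ _, ha⟩
  have h := (Finset.card_le_card hsub).trans Finset.card_image_le
  simpa using h

/-! ### The point locus and the associated graded ideal -/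

/-- The point `(α_{w₁}, …, α_{wₙ})` of a packed word `w`. The parameters `α₁, …, αₙ` are
indexed by `Fin n`, so that `α_m` is the value of `α` at `m - 1`. -/
def point {n : ℕ} (α : Fin n → ℚ) (w : Fin n → ℕ+) (hw : IsPacked w) : Fin n → ℚ :=
  fun j => α ⟨(w j : ℕ) - 1, by have := hw.letter_le j; have := (w j).pos; omega⟩

/-- The locus `Xₙ,ₖ ⊆ ℚⁿ` of the points of all words in `𝒲ₙ,ₖ`. -/
def locus {n : ℕ} (α : Fin n → ℚ) (k : ℕ) : Set (Fin n → ℚ) :=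
  Set.range fun w : PackedWordGE n k => point α w.1 w.2.1

/-- The highest degree component of a nonzero polynomial. -/
def topComponent {n : ℕ} (f : MvPolynomial (Fin n) ℚ) : MvPolynomial (Fin n) ℚ :=
  homogeneousComponent f.totalDegree f

/-- The associated graded ideal `T(X)` of the ideal `I(X)` of polynomials vanishing on `X`. -/
def assocGradedIdeal {n : ℕ} (X : Set (Fin n → ℚ)) : Ideal (MvPolynomial (Fin n) ℚ) :=
  Ideal.span {g | ∃ f ∈ vanishingIdeal ℚ X, f ≠ 0 ∧ g = topComponent f}

/-! ### The ideals `Jₙ` and `Jₙ,ₖ` -/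

/-- `e_d` in the variables other than `x_i`. -/
def esymmOmit {n : ℕ} (i : Fin n) (d : ℕ) : MvPolynomial (Fin n) ℚ :=
  ∑ s ∈ (Finset.univ.erase i).powersetCard d, ∏ j ∈ s, X j

/-- The generators `x_i ^ d * e_{n-r}^{(i)}` with `1 ≤ r ≤ d`. Those with `r > n` are zero (an
elementary symmetric polynomial of negative degree is zero) and are left out. -/
def gensJ (n : ℕ) : Set (MvPolynomial (Fin n) ℚ) :=
  {g | ∃ (i : Fin n) (d r : ℕ), 1 ≤ r ∧ r ≤ d ∧ r ≤ n ∧ g = X i ^ d * esymmOmit i (n - r)}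

/-- The ideal `Jₙ`. -/
def idealJ (n : ℕ) : Ideal (MvPolynomial (Fin n) ℚ) :=
  Ideal.span (gensJ n)

/-- The ideal `Jₙ,ₖ = Jₙ + ⟨eₙ, eₙ₋₁, …, eₙ₋ₖ₊₁⟩`. -/
def idealJGE (n k : ℕ) : Ideal (MvPolynomial (Fin n) ℚ) :=
  idealJ n ⊔ Ideal.span {g | ∃ d : ℕ, n + 1 ≤ d + k ∧ d ≤ n ∧ g = esymm (Fin n) ℚ d}

theorem rename_esymmOmit {n : ℕ} (σ : Equiv.Perm (Fin n)) (i : Fin n) (d : ℕ) :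
    rename σ (esymmOmit i d) = esymmOmit (σ i) d := by
  unfold esymmOmit
  have h : (Finset.univ.erase (σ i)) = (Finset.univ.erase i).map σ.toEmbedding := by
    ext j
    simp
  rw [h, Finset.powersetCard_map, Finset.sum_map, map_sum]
  refine Finset.sum_congr rfl fun s _ => ?_
  simp [Finset.mapEmbedding_apply, map_prod]

theorem idealJ_le_comap (n : ℕ) (σ : Equiv.Perm (Fin n)) :
    idealJ n ≤ (idealJ n).comap (rename (R := ℚ) σ) := by
  refine Ideal.span_le.mpr ?_
  rintro _ ⟨i, d, r, h1, h2, h3, rfl⟩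
  refine Ideal.subset_span ⟨σ i, d, r, h1, h2, h3, ?_⟩
  simp [rename_esymmOmit]

theorem idealJGE_le_comap (n k : ℕ) (σ : Equiv.Perm (Fin n)) :
    idealJGE n k ≤ (idealJGE n k).comap (rename (R := ℚ) σ) := by
  refine sup_le ((idealJ_le_comap n σ).trans (Ideal.comap_mono le_sup_left)) ?_
  refine Ideal.span_le.mpr ?_
  rintro _ ⟨d, h1, h2, rfl⟩
  refine (le_sup_right : _ ≤ idealJGE n k) (Ideal.subset_span ⟨d, h1, h2, ?_⟩)
  exact esymm_isSymmetric (Fin n) ℚ d σ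

/-! ### The quotient rings as representations of the symmetric group -/

/-- The representation of the symmetric group on `ℚ[x₁, …, xₙ] / I` induced by
`σ • x_i = x_{σ i}`, for an ideal `I` that is stable under this action. -/
def quotientRep {n : ℕ} (I : Ideal (MvPolynomial (Fin n) ℚ))
    (hI : ∀ σ : Equiv.Perm (Fin n), I ≤ I.comap (rename (R := ℚ) σ)) :
    Representation ℚ (Equiv.Perm (Fin n)) (MvPolynomial (Fin n) ℚ ⧸ I) where
  toFun σ := (Ideal.quotientMapₐ I (rename (R := ℚ) σ) (hI σ)).toLinearMap
  map_one' := by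
    refine LinearMap.ext fun x => ?_
    obtain ⟨p, rfl⟩ := Ideal.Quotient.mk_surjective x
    simp [Equiv.Perm.coe_one]
  map_mul' σ τ := by
    refine LinearMap.ext fun x => ?_
    obtain ⟨p, rfl⟩ := Ideal.Quotient.mk_surjective x
    simp [Equiv.Perm.coe_mul, rename_rename]

/-- `Sₙ = ℚ[x₁, …, xₙ] / Jₙ`. -/
abbrev RingS (n : ℕ) : Type := MvPolynomial (Fin n) ℚ ⧸ idealJ n

/-- `Sₙ,ₖ = ℚ[x₁, …, xₙ] / Jₙ,ₖ`. -/
abbrev RingSGE (n k : ℕ) : Type := MvPolynomial (Fin n) ℚ ⧸ idealJGE n k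

/-- `Sₙ` as an ungraded module of the symmetric group. -/
def repS (n : ℕ) : Representation ℚ (Equiv.Perm (Fin n)) (RingS n) :=
  quotientRep (idealJ n) (idealJ_le_comap n)

/-- `Sₙ,ₖ` as an ungraded module of the symmetric group. -/
def repSGE (n k : ℕ) : Representation ℚ (Equiv.Perm (Fin n)) (RingSGE n k) :=
  quotientRep (idealJGE n k) (idealJGE_le_comap n k)

end PackedWordQuotient

end

noncomputable section

namespace PackedWordQuotient

/-! ### Codimension bounds -/

/-! The proof is a dimension squeeze for J = J_{n,k} and X = X_{n,k}: J ⊆ T(X), the codimension of J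
is at most |X|, and ℚ[x]/T(X) surjects onto a space of dimension |X|.

Containment: each generator of J is, up to sign and a power of x_i, the leading form of an explicit
polynomial vanishing on X. This is a divided difference in t of ∏ (t - x_j) at the first few α's,
multiplied by a product of factors x_i - α_l in the case of J_n (`esymm_mem_assocGradedIdeal`,
`gensJ_subset_assocGradedIdeal`).

Upper bound: adjoining e_{n-k} to J_{n,k} gives J_{n,k+1}, and e_{n-k} multiplies the generalized
coinvariant ideal ⟨x_i^k, e_n, …, e_{n-k+1}⟩ into J_{n,k}. That ideal has codimension at most the
number of surjections [n] → [k] (`spansMod_coinvIdeal`). Summing over all j ≥ k gives at most the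
number of packed words (`spansMod_idealJGE`, `sum_coverCount_le`).

Lower bound: filter the functions on X by the degree of polynomials representing them, and let q_d
be an equivariant projection onto the functions of degree < d. Sending f of degree d to (1 -
q_d)(f|_X) defines an equivariant surjection onto ℚ[W] that kills T(X)
(`exists_equivariant_surjection`). It factors through ℚ[x]/J, where the upper bound makes it an
isomorphism, and this forces T(X) ⊆ J (`equiv_of_le_assocGradedIdeal`). -/

/-- The ideal `I` has codimension at most `N`: some `N` elements span `A` modulo `I`. -/
def SpansMod {A : Type*} [CommRing A] [Algebra ℚ A] (I : Ideal A) (N : ℕ) : Prop :=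
  ∃ B : Finset A, B.card ≤ N ∧ ∀ p, ∃ q ∈ Submodule.span ℚ (B : Set A), p - q ∈ I

section SpansMod

variable {A : Type*} [CommRing A] [Algebra ℚ A]

theorem SpansMod.mono {I J : Ideal A} {N M : ℕ} (h : SpansMod I N) (hIJ : I ≤ J) (hNM : N ≤ M) :
    SpansMod J M := by
  obtain ⟨B, hB, h⟩ := h
  refine ⟨B, hB.trans hNM, fun p => ?_⟩
  obtain ⟨q, hq, hp⟩ := h p
  exact ⟨q, hq, hIJ hp⟩

theorem spansMod_top : SpansMod (⊤ : Ideal A) 0 :=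
  ⟨∅, by simp, fun _ => ⟨0, by simp, by simp⟩⟩

/-- If `g K ⊆ I`, then the codimension of `I` is at most that of `I + (g)` plus that of `K`. -/
theorem SpansMod.of_mul {I I' K : Ideal A} {N M : ℕ} (g : A) (hI' : SpansMod I' N)
    (hK : SpansMod K M) (hle : I' ≤ I ⊔ Ideal.span {g}) (hg : ∀ a ∈ K, g * a ∈ I) :
    SpansMod I (N + M) := by
  classical
  obtain ⟨B, hB, h⟩ := hI'
  obtain ⟨C, hC, h'⟩ := hK
  refine ⟨B ∪ C.image (g * ·), ?_, fun p => ?_⟩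
  · exact (Finset.card_union_le _ _).trans (add_le_add hB (Finset.card_image_le.trans hC))
  obtain ⟨q, hq, hp⟩ := h p
  -- The error p - q is a multiple a * g modulo I; the factor a only matters modulo K, so it can be
  -- reduced to the span of C.
  obtain ⟨i, hi, y, hy, hiy⟩ := Submodule.mem_sup.mp (hle hp)
  obtain ⟨a, rfl⟩ := Ideal.mem_span_singleton'.mp hy
  obtain ⟨q', hq', ha⟩ := h' a
  refine ⟨q + g * q', Submodule.add_mem _ ?_ ?_, ?_⟩
  · exact Submodule.span_mono (by simp) hq
  · have : g * q' ∈ (Submodule.span ℚ (C : Set A)).map (LinearMap.mulLeft ℚ g) :=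
      ⟨q', hq', rfl⟩
    rw [Submodule.map_span] at this
    refine Submodule.span_mono ?_ this
    rw [Finset.coe_union, Finset.coe_image]
    exact Set.subset_union_right
  · have : p - (q + g * q') = i + g * (a - q') := by
      linear_combination -hiy
    rw [this]
    exact I.add_mem hi (hg _ ha)

theorem SpansMod.finite {I : Ideal A} {N : ℕ} (h : SpansMod I N) :
    Module.Finite ℚ (A ⧸ I) ∧ Module.finrank ℚ (A ⧸ I) ≤ N := by
  classical
  obtain ⟨B, hB, h⟩ := h
  let C : Finset (A ⧸ I) := B.image (Ideal.Quotient.mkₐ ℚ I)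
  have hC : Submodule.span ℚ (C : Set (A ⧸ I)) = ⊤ := by
    refine eq_top_iff.mpr fun x _ => ?_
    obtain ⟨p, rfl⟩ := Ideal.Quotient.mk_surjective x
    obtain ⟨q, hq, hp⟩ := h p
    rw [Ideal.Quotient.eq.mpr hp]
    have : Ideal.Quotient.mk I q ∈
        (Submodule.span ℚ (B : Set A)).map (Ideal.Quotient.mkₐ ℚ I).toLinearMap := ⟨q, hq, rfl⟩
    rw [Submodule.map_span] at this
    simpa [C] using this
  refine ⟨⟨⟨C, hC⟩⟩, ?_⟩
  have := finrank_span_finset_le_card (R := ℚ) C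
  rw [Set.finrank, hC, finrank_top] at this
  exact this.trans (Finset.card_image_le.trans hB)

end SpansMod

/-! ### Elementary symmetric polynomials in a subset of the variables -/

section Esymm

variable {ι : Type*}

/-- `e_d` in the variables indexed by `T`. -/
def esymmOn (T : Finset ι) (d : ℕ) : MvPolynomial ι ℚ :=
  ∑ s ∈ T.powersetCard d, ∏ j ∈ s, X j

theorem esymmOn_zero (T : Finset ι) : esymmOn T 0 = 1 := by simp [esymmOn]

theorem esymmOn_of_card_lt {T : Finset ι} {d : ℕ} (h : T.card < d) : esymmOn T d = 0 := by
  simp [esymmOn, Finset.powersetCard_eq_empty.mpr h]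

theorem esymmOn_insert_succ [DecidableEq ι] {T : Finset ι} {a : ι} (ha : a ∉ T)
    (d : ℕ) :
    esymmOn (insert a T) (d + 1) = esymmOn T (d + 1) + X a * esymmOn T d := by
  unfold esymmOn
  rw [Finset.powersetCard_succ_insert ha, Finset.sum_union, Finset.sum_image, Finset.mul_sum]
  · congr 1
    refine Finset.sum_congr rfl fun s hs => ?_
    rw [Finset.prod_insert fun h => ha ((Finset.mem_powersetCard.mp hs).1 h)]
  · intro s hs t ht hst
    have hs' : a ∉ s := fun h => ha ((Finset.mem_powersetCard.mp hs).1 h)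
    have ht' : a ∉ t := fun h => ha ((Finset.mem_powersetCard.mp ht).1 h)
    rw [← Finset.erase_insert hs', ← Finset.erase_insert ht', hst]
  · rw [Finset.disjoint_left]
    intro s hs hs'
    obtain ⟨t, -, rfl⟩ := Finset.mem_image.mp hs'
    exact ha ((Finset.mem_powersetCard.mp hs).1 (Finset.mem_insert_self a t))

/-! ### The generalized coinvariant ideals -/

/-- The ideal generated by `x_i ^ k` and the top `s` elementary symmetric polynomials in the
variables indexed by `T`, together with all the other variables. -/
def coinvIdeal (T : Finset ι) (k s : ℕ) : Ideal (MvPolynomial ι ℚ) :=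
  Ideal.span ({g | ∃ i ∈ T, g = X i ^ k} ∪ {g | ∃ i ∉ T, g = X i} ∪
    {g | ∃ d, T.card + 1 ≤ d + s ∧ g = esymmOn T d})

theorem X_pow_mem_coinvIdeal {T : Finset ι} {i : ι} (hi : i ∈ T) (k s : ℕ) :
    X i ^ k ∈ coinvIdeal T k s :=
  Ideal.subset_span (Or.inl (Or.inl ⟨i, hi, rfl⟩))

theorem X_mem_coinvIdeal {T : Finset ι} {i : ι} (hi : i ∉ T) (k s : ℕ) :
    X i ∈ coinvIdeal T k s :=
  Ideal.subset_span (Or.inl (Or.inr ⟨i, hi, rfl⟩))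

theorem esymmOn_mem_coinvIdeal {T : Finset ι} (k : ℕ) {d s : ℕ} (h : T.card + 1 ≤ d + s) :
    esymmOn T d ∈ coinvIdeal T k s :=
  Ideal.subset_span (Or.inr ⟨d, h, rfl⟩)

/-- The number of maps from a set of `t` elements to `{1, …, k}` whose image contains
`{1, …, s}`, by recursion on `t`. -/
def coverCount (k : ℕ) : ℕ → ℕ → ℕ
  | 0, s => if s = 0 then 1 else 0
  | t + 1, s => s * coverCount k t (s - 1) + (k - s) * coverCount k t s

/-- The relation x_a e_d(T) = e_{d+1}(T ∪ a) - e_{d+1}(T) trades each power of x_a for one more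
degree, until the degree exceeds |T|. -/
theorem pow_mul_esymmOn_mem [DecidableEq ι] {T : Finset ι} {a : ι} (ha : a ∉ T) (k : ℕ)
    {s : ℕ} (m d : ℕ) (h1 : T.card + 1 ≤ d + s) (h2 : T.card + 1 ≤ d + m) :
    X a ^ m * esymmOn T d ∈ coinvIdeal (insert a T) k s := by
  induction m generalizing d with
  | zero => simp [esymmOn_of_card_lt (show T.card < d by omega)]
  | succ m ih =>
    have h : X a ^ (m + 1) * esymmOn T d =
        X a ^ m * esymmOn (insert a T) (d + 1) - X a ^ m * esymmOn T (d + 1) := by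
      rw [esymmOn_insert_succ ha]; ring
    rw [h]
    refine Ideal.sub_mem _ (Ideal.mul_mem_left _ _ (esymmOn_mem_coinvIdeal k ?_))
      (ih _ (by omega) (by omega))
    rw [Finset.card_insert_of_notMem ha]
    omega

/-- Only the elementary symmetric generators need a hypothesis: the others lie in the larger ideal
already, except x_a, which turns x_a^j into x_a^(j+1). -/
theorem pow_mul_mem_of_mem_coinvIdeal [DecidableEq ι] {T : Finset ι} {a : ι} (ha : a ∉ T)
    (k : ℕ) {s s' : ℕ} (j : ℕ) (hs : ∀ d, T.card + 1 ≤ d + s' →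
      X a ^ j * esymmOn T d ∈ coinvIdeal (insert a T) k s ⊔ Ideal.span {X a ^ (j + 1)})
    (p : MvPolynomial ι ℚ) (hp : p ∈ coinvIdeal T k s') :
    X a ^ j * p ∈ coinvIdeal (insert a T) k s ⊔ Ideal.span {X a ^ (j + 1)} := by
  revert p
  suffices h : coinvIdeal T k s' ≤ Submodule.comap
      (LinearMap.mulLeft (MvPolynomial ι ℚ) (X a ^ j : MvPolynomial ι ℚ))
      (coinvIdeal (insert a T) k s ⊔ Ideal.span {X a ^ (j + 1)}) from fun p hp => h hp
  refine Ideal.span_le.mpr ?_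
  rintro _ ((⟨i, hi, rfl⟩ | ⟨i, hi, rfl⟩) | ⟨d, hd, rfl⟩)
  · exact Ideal.mul_mem_left _ _ (Ideal.mem_sup_left
      (X_pow_mem_coinvIdeal (Finset.mem_insert_of_mem hi) k s))
  · by_cases hia : i = a
    · subst hia
      refine Ideal.mem_sup_right ?_
      change X i ^ j * X i ∈ _
      rw [← pow_succ]
      exact Ideal.mem_span_singleton_self _
    · exact Ideal.mul_mem_left _ _ (Ideal.mem_sup_left
        (X_mem_coinvIdeal (by simp [hi, hia]) k s))
  · exact hs d hd

/-- Filter the quotient by powers of x_a. The layer x_a^j is a quotient of the ring for T with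
parameter s - 1 if j < s, and with parameter s if j ≥ s. This mirrors choosing the letter at
position a: s choices fulfil a requirement, the others do not. -/
theorem spansMod_coinvIdeal_sup_pow [DecidableEq ι] {T : Finset ι} {a : ι} (ha : a ∉ T) {k s : ℕ}
    (N M : ℕ) (hN : 1 ≤ s → SpansMod (coinvIdeal T k (s - 1)) N) (hM : SpansMod (coinvIdeal T k s) M)
    (j : ℕ) :
    SpansMod (coinvIdeal (insert a T) k s ⊔ Ideal.span {X a ^ j})
      (min j s * N + (j - s) * M) := by
  induction j with
  | zero =>
    refine spansMod_top.mono ?_ (by simp)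
    rw [pow_zero, Ideal.span_singleton_one, sup_top_eq]
  | succ j ih =>
    have hle : coinvIdeal (insert a T) k s ⊔ Ideal.span {X a ^ j} ≤
        (coinvIdeal (insert a T) k s ⊔ Ideal.span {X a ^ (j + 1)}) ⊔ Ideal.span {X a ^ j} :=
      sup_le_sup_right le_sup_left _
    rcases lt_or_ge j s with hj | hj
    · have := SpansMod.of_mul (X a ^ j) ih (hN (by omega)) hle
        (pow_mul_mem_of_mem_coinvIdeal ha k j fun d hd => ?_)
      · refine this.mono le_rfl (le_of_eq ?_)
        rw [min_eq_left hj.le, min_eq_left (by omega : j + 1 ≤ s),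
          Nat.sub_eq_zero_of_le hj.le, Nat.sub_eq_zero_of_le (by omega : j + 1 ≤ s)]
        ring
      · cases d with
        | zero =>
          -- In degree 0 the bound on s is already large enough for the ideal of `insert a T` to
          -- contain e_0 = 1.
          refine Ideal.mul_mem_left _ _ (Ideal.mem_sup_left ?_)
          rw [esymmOn_zero, ← esymmOn_zero (insert a T)]
          refine esymmOn_mem_coinvIdeal k ?_
          rw [Finset.card_insert_of_notMem ha]
          omega
        | succ d =>
          have h : X a ^ j * esymmOn T (d + 1) =
              X a ^ j * esymmOn (insert a T) (d + 1) - esymmOn T d * X a ^ (j + 1) := by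
            rw [esymmOn_insert_succ ha]; ring
          rw [h]
          refine Ideal.sub_mem _ (Ideal.mul_mem_left _ _ (Ideal.mem_sup_left
            (esymmOn_mem_coinvIdeal k ?_)))
            (Ideal.mul_mem_left _ _ (Ideal.mem_sup_right (Ideal.mem_span_singleton_self _)))
          rw [Finset.card_insert_of_notMem ha]
          omega
    · have := SpansMod.of_mul (X a ^ j) ih hM hle
        (pow_mul_mem_of_mem_coinvIdeal ha k j fun d hd =>
          Ideal.mem_sup_left (pow_mul_esymmOn_mem ha k j d hd (by omega)))
      refine this.mono le_rfl (le_of_eq ?_)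
      rw [min_eq_right hj, min_eq_right (by omega : s ≤ j + 1), Nat.sub_add_comm hj]
      ring

theorem spansMod_coinvIdeal [DecidableEq ι] (k : ℕ) (T : Finset ι) (s : ℕ) (hs : s ≤ k) :
    SpansMod (coinvIdeal T k s) (coverCount k T.card s) := by
  induction T using Finset.induction_on generalizing s with
  | empty =>
    rcases Nat.eq_zero_or_pos s with rfl | hpos
    · refine ⟨{1}, by simp [coverCount], fun p => ?_⟩
      refine ⟨C (constantCoeff p), ?_, ?_⟩
      · rw [Finset.coe_singleton, Submodule.mem_span_singleton]
        exact ⟨constantCoeff p, by rw [← algebraMap_eq, Algebra.algebraMap_eq_smul_one]⟩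
      · induction p using MvPolynomial.induction_on with
        | C a => simp
        | add p q hp hq =>
          convert Ideal.add_mem _ hp hq using 1
          simp only [map_add]
          ring
        | mul_X p i _ =>
          rw [map_mul, constantCoeff_X, mul_zero, C_0, sub_zero]
          exact Ideal.mul_mem_left _ _ (X_mem_coinvIdeal (by simp) k 0)
    · refine spansMod_top.mono ?_ (Nat.zero_le _)
      rw [top_le_iff, Ideal.eq_top_iff_one, ← esymmOn_zero (∅ : Finset ι)]
      exact esymmOn_mem_coinvIdeal k (by simpa [Nat.one_le_iff_ne_zero] using hpos.ne')
  | insert a T ha ih =>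
    have := spansMod_coinvIdeal_sup_pow ha _ _ (fun h => ih (s - 1) (by omega)) (ih s hs) k
    -- Taking the exponent to be k adds nothing to the ideal, and the bound becomes the recursion of
    -- `coverCount`.
    refine this.mono (sup_le le_rfl ?_) (le_of_eq ?_)
    · rw [Ideal.span_singleton_le_iff_mem]
      exact X_pow_mem_coinvIdeal (Finset.mem_insert_self a T) k s
    · rw [Finset.card_insert_of_notMem ha, min_eq_right hs, coverCount]

end Esymm

/-! ### The codimension of `Jₙ,ₖ` -/

theorem esymmOmit_eq {n : ℕ} (i : Fin n) (d : ℕ) :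
    esymmOmit i d = esymmOn (Finset.univ.erase i) d := rfl

theorem esymm_eq_esymmOn {n : ℕ} (d : ℕ) : esymm (Fin n) ℚ d = esymmOn Finset.univ d := rfl

theorem pow_mul_esymmOmit_mem {n k : ℕ} (i : Fin n) (d r : ℕ) (h1 : 1 ≤ r) (h2 : r ≤ d)
    (h3 : r ≤ n) : X i ^ d * esymmOmit i (n - r) ∈ idealJGE n k :=
  Ideal.mem_sup_left (Ideal.subset_span ⟨i, d, r, h1, h2, h3, rfl⟩)

theorem esymmOn_univ_mem {n k d : ℕ} (h : n + 1 ≤ d + k) :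
    esymmOn Finset.univ d ∈ idealJGE n k := by
  rcases le_or_gt d n with hd | hd
  · exact Ideal.mem_sup_right (Ideal.subset_span ⟨d, h, hd, rfl⟩)
  · rw [esymmOn_of_card_lt (by simpa using hd)]
    exact zero_mem _

theorem esymmOn_univ_succ {n : ℕ} (i : Fin n) (d : ℕ) :
    esymmOn Finset.univ (d + 1) = esymmOmit i (d + 1) + X i * esymmOmit i d := by
  rw [esymmOmit_eq, esymmOmit_eq, ← esymmOn_insert_succ (Finset.notMem_erase i _),
    Finset.insert_erase (Finset.mem_univ i)]

/-- The key identity is x_i^k e_{n-k} = x_i^k e_{n-k}^{(i)} + x_i^(k+1) e_{n-k-1}^{(i)}, a sum of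
two generators of J_n, with d = r = k and d = r = k + 1. For k = n the second term is absent. -/
theorem esymmOn_mul_mem_idealJGE {n k : ℕ} (hk : 1 ≤ k) (hkn : k ≤ n)
    (p : MvPolynomial (Fin n) ℚ) (hp : p ∈ coinvIdeal Finset.univ k k) :
    esymmOn Finset.univ (n - k) * p ∈ idealJGE n k := by
  revert p
  suffices h : coinvIdeal Finset.univ k k ≤ Submodule.comap
      (LinearMap.mulLeft (MvPolynomial (Fin n) ℚ) (esymmOn Finset.univ (n - k)))
      (idealJGE n k) from fun p hp => h hp
  refine Ideal.span_le.mpr ?_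
  rintro _ ((⟨i, -, rfl⟩ | ⟨i, hi, rfl⟩) | ⟨d, hd, rfl⟩)
  · change esymmOn Finset.univ (n - k) * X i ^ k ∈ idealJGE n k
    rcases hkn.eq_or_lt with rfl | hlt
    · have h := pow_mul_esymmOmit_mem (k := k) i k k hk le_rfl le_rfl
      rw [Nat.sub_self, esymmOmit_eq, esymmOn_zero] at h
      rwa [Nat.sub_self, esymmOn_zero, mul_comm]
    · obtain ⟨m, hm⟩ : ∃ m, n - k = m + 1 := ⟨n - k - 1, by omega⟩
      have h1 := pow_mul_esymmOmit_mem (k := k) i k k hk le_rfl hkn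
      have h2 := pow_mul_esymmOmit_mem (k := k) i (k + 1) (k + 1) (by omega) le_rfl hlt
      rw [hm] at h1 ⊢
      rw [show n - (k + 1) = m by omega] at h2
      rw [esymmOn_univ_succ i]
      convert Ideal.add_mem _ h1 h2 using 1
      ring
  · simp at hi
  · exact Ideal.mul_mem_left _ _ (esymmOn_univ_mem (by simpa using hd))

/-- Descending induction on k. The range extends to k = n + 1 because there e_0 = 1 makes the ideal
trivial, which starts the induction. -/
theorem spansMod_idealJGE {n k : ℕ} (hk : 1 ≤ k) (hkn : k ≤ n + 1) :
    SpansMod (idealJGE n k) (∑ j ∈ Finset.Ico k (n + 1), coverCount j n j) := by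
  obtain ⟨m, hm⟩ := Nat.exists_eq_add_of_le hkn
  induction m generalizing k with
  | zero =>
    refine spansMod_top.mono ?_ (Nat.zero_le _)
    rw [top_le_iff, Ideal.eq_top_iff_one, ← esymmOn_zero Finset.univ]
    exact esymmOn_univ_mem (by omega)
  | succ m ih =>
    have hK := spansMod_coinvIdeal k (Finset.univ : Finset (Fin n)) k le_rfl
    have := SpansMod.of_mul (esymmOn Finset.univ (n - k)) (ih (k := k + 1) (by omega) (by omega) (by omega))
      hK (I := idealJGE n k)
      ?_ (esymmOn_mul_mem_idealJGE hk (by omega))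
    · refine this.mono le_rfl (le_of_eq ?_)
      rw [Finset.sum_eq_sum_Ico_succ_bot (show k < n + 1 by omega), Finset.card_univ, Fintype.card_fin, add_comm]
    · refine sup_le (le_sup_left.trans le_sup_left) (Ideal.span_le.mpr ?_)
      rintro _ ⟨d, h1, h2, rfl⟩
      rw [esymm_eq_esymmOn]
      rcases eq_or_ne d (n - k) with rfl | hd
      · exact Ideal.mem_sup_right (Ideal.mem_span_singleton_self _)
      · exact Ideal.mem_sup_left (esymmOn_univ_mem (by omega))

/-! ### Polynomials of bounded degree and leading forms -/

section LeadingForm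

variable {ι : Type*}

/-- The polynomials of total degree less than `d`. -/
def degLT (ι : Type*) (d : ℕ) : Submodule ℚ (MvPolynomial ι ℚ) :=
  Submodule.span ℚ {f | ∃ i < d, f.IsHomogeneous i}

theorem IsHomogeneous.mem_degLT {f : MvPolynomial ι ℚ} {i d : ℕ} (hf : f.IsHomogeneous i)
    (h : i < d) : f ∈ degLT ι d :=
  Submodule.subset_span ⟨i, h, hf⟩

theorem degLT_mono {d e : ℕ} (h : d ≤ e) : degLT ι d ≤ degLT ι e := by
  refine Submodule.span_mono ?_
  rintro f ⟨i, hi, hf⟩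
  exact ⟨i, hi.trans_le h, hf⟩

theorem mem_degLT_totalDegree_succ (f : MvPolynomial ι ℚ) : f ∈ degLT ι (f.totalDegree + 1) := by
  have h := Submodule.sum_mem (degLT ι (f.totalDegree + 1)) fun i hi =>
    IsHomogeneous.mem_degLT (homogeneousComponent_isHomogeneous i f) (Finset.mem_range.mp hi)
  rwa [sum_homogeneousComponent] at h

theorem totalDegree_le_of_mem_degLT {f : MvPolynomial ι ℚ} {d : ℕ} (hf : f ∈ degLT ι (d + 1)) :
    f.totalDegree ≤ d := by
  induction hf using Submodule.span_induction with
  | mem f hf =>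
    obtain ⟨i, hi, hf⟩ := hf
    exact hf.totalDegree_le.trans (by omega)
  | zero => simp
  | add f g _ _ hf hg => exact (totalDegree_add f g).trans (max_le hf hg)
  | smul a f _ hf => exact (totalDegree_smul_le a f).trans hf

theorem homogeneousComponent_of_mem_degLT {f : MvPolynomial ι ℚ} {d : ℕ} (hf : f ∈ degLT ι d) :
    homogeneousComponent d f = 0 := by
  cases d with
  | zero =>
    have : f = 0 := by simpa [degLT] using hf
    rw [this, map_zero]
  | succ d =>
    exact homogeneousComponent_eq_zero (d + 1) f
      (Nat.lt_succ_of_le (totalDegree_le_of_mem_degLT hf))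

theorem mul_mem_degLT {f g : MvPolynomial ι ℚ} {d e : ℕ} (hf : f.IsHomogeneous d)
    (hg : g ∈ degLT ι e) : f * g ∈ degLT ι (d + e) := by
  induction hg using Submodule.span_induction with
  | mem g hg =>
    obtain ⟨i, hi, hg⟩ := hg
    exact IsHomogeneous.mem_degLT (hf.mul hg) (by omega)
  | zero => simp
  | add g h _ _ hg hh => rw [mul_add]; exact Submodule.add_mem _ hg hh
  | smul a g _ hg => rw [mul_smul_comm]; exact Submodule.smul_mem _ a hg

/-- `g` is the homogeneous component of `f` of degree `d`, and `f` has no components of degree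
greater than `d`. -/
def HasLeadingForm (f g : MvPolynomial ι ℚ) (d : ℕ) : Prop :=
  g.IsHomogeneous d ∧ f - g ∈ degLT ι d

theorem HasLeadingForm.mul {f g f' g' : MvPolynomial ι ℚ} {d d' : ℕ} (h : HasLeadingForm f g d)
    (h' : HasLeadingForm f' g' d') : HasLeadingForm (f * f') (g * g') (d + d') := by
  refine ⟨h.1.mul h'.1, ?_⟩
  have key : f * f' - g * g' = g * (f' - g') + (g' * (f - g) + (f - g) * (f' - g')) := by ring
  rw [key]
  refine Submodule.add_mem _ (mul_mem_degLT h.1 h'.2) (Submodule.add_mem _ ?_ ?_)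
  · rw [add_comm d]; exact mul_mem_degLT h'.1 h.2
  · have h2 := h.2
    generalize f - g = t at h2
    induction h2 using Submodule.span_induction with
    | mem r hr =>
      obtain ⟨i, hi, hr⟩ := hr
      exact degLT_mono (by omega) (mul_mem_degLT hr h'.2)
    | zero => simp
    | add r s _ _ hr hs => rw [add_mul]; exact Submodule.add_mem _ hr hs
    | smul a r _ hr => rw [smul_mul_assoc]; exact Submodule.smul_mem _ a hr

theorem hasLeadingForm_X_sub_C (i : ι) (a : ℚ) :
    HasLeadingForm (X i - C a : MvPolynomial ι ℚ) (X i) 1 := by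
  refine ⟨isHomogeneous_X ℚ i, ?_⟩
  rw [sub_sub_cancel_left]
  exact Submodule.neg_mem _ (IsHomogeneous.mem_degLT (isHomogeneous_C ι a) one_pos)

theorem hasLeadingForm_prod_X_sub_C {κ : Type*} (i : ι) (a : κ → ℚ) (S : Finset κ) :
    HasLeadingForm (∏ l ∈ S, (X i - C (a l)) : MvPolynomial ι ℚ) (X i ^ S.card) S.card := by
  classical
  induction S using Finset.induction_on with
  | empty => exact ⟨by simpa using isHomogeneous_one ι ℚ, by simp⟩
  | insert l S hl ih =>
    rw [Finset.prod_insert hl, Finset.card_insert_of_notMem hl, pow_succ', add_comm]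
    exact (hasLeadingForm_X_sub_C i (a l)).mul ih

theorem hasLeadingForm_homogeneousComponent (f : MvPolynomial ι ℚ) :
    HasLeadingForm f (homogeneousComponent f.totalDegree f) f.totalDegree := by
  refine ⟨homogeneousComponent_isHomogeneous _ f, ?_⟩
  have h := Submodule.sum_mem (degLT ι f.totalDegree) fun i hi =>
    IsHomogeneous.mem_degLT (homogeneousComponent_isHomogeneous i f) (Finset.mem_range.mp hi)
  rwa [← add_sub_cancel_right (∑ i ∈ Finset.range f.totalDegree, homogeneousComponent i f)
    (homogeneousComponent f.totalDegree f), ← Finset.sum_range_succ,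
    sum_homogeneousComponent] at h

theorem HasLeadingForm.homogeneousComponent_eq {f g : MvPolynomial ι ℚ} {d : ℕ}
    (h : HasLeadingForm f g d) : homogeneousComponent d f = g := by
  have := homogeneousComponent_of_mem_degLT h.2
  rwa [map_sub, homogeneousComponent_eq_self h.1, sub_eq_zero] at this

theorem HasLeadingForm.totalDegree_eq {f g : MvPolynomial ι ℚ} {d : ℕ}
    (h : HasLeadingForm f g d) (hg : g ≠ 0) : f.totalDegree = d := by
  refine le_antisymm (totalDegree_le_of_mem_degLT ?_) (not_lt.mp fun hlt => hg ?_)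
  · rw [← sub_add_cancel f g]
    exact Submodule.add_mem _ (degLT_mono d.le_succ h.2)
      (IsHomogeneous.mem_degLT h.1 d.lt_succ_self)
  · rw [← h.homogeneousComponent_eq, homogeneousComponent_eq_zero _ _ hlt]

end LeadingForm

/-- `HasLeadingForm` allows g = 0, so no leading form has to be shown nonzero when this is applied.
-/
theorem HasLeadingForm.mem_assocGradedIdeal {n : ℕ} {f g : MvPolynomial (Fin n) ℚ} {d : ℕ}
    (h : HasLeadingForm f g d) {Y : Set (Fin n → ℚ)} (hf : f ∈ vanishingIdeal ℚ Y) :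
    g ∈ assocGradedIdeal Y := by
  rcases eq_or_ne g 0 with rfl | hg
  · exact zero_mem _
  · have hd := h.totalDegree_eq hg
    refine Ideal.subset_span ⟨f, hf, ?_, ?_⟩
    · rintro rfl
      exact hg (by rw [← h.homogeneousComponent_eq, map_zero])
    · rw [topComponent, hd, h.homogeneousComponent_eq]

/-! ### Polynomials vanishing on the points of packed words -/

section Vanishing

variable {ι κ : Type*} [DecidableEq κ]

/-- The divided difference at the nodes `a_l`, `l ∈ S`, of the polynomial `∏ (t - x_j)`, `j ∈ T`,
in the variable `t`. -/
def dividedDifference (a : κ → ℚ) (S : Finset κ) (T : Finset ι) : MvPolynomial ι ℚ :=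
  ∑ l ∈ S, C (∏ m ∈ S.erase l, (a l - a m))⁻¹ * ∏ j ∈ T, (C (a l) - X j)

/-- Lagrange interpolation at |S| nodes reproduces t^e; the sum is its coefficient in degree |S| -
1. -/
theorem sum_pow_div_prod_eq {a : κ → ℚ} (ha : Function.Injective a) {S : Finset κ} {e : ℕ}
    (he : e < S.card) :
    ∑ l ∈ S, a l ^ e / ∏ m ∈ S.erase l, (a l - a m) = if e = S.card - 1 then 1 else 0 := by
  have := Lagrange.coeff_eq_sum (s := S) (v := a) ha.injOn (P := Polynomial.X ^ e)
    (by rw [Polynomial.degree_X_pow]; exact_mod_cast he)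
  rw [Polynomial.coeff_X_pow] at this
  simpa [eq_comm] using this.symm

/-- Expanding the products, the coefficient of ∏_{j ∈ U} x_j is, up to sign, the divided difference
of t^(|T| - |U|). It vanishes for |U| > d and equals 1 for |U| = d. -/
theorem hasLeadingForm_dividedDifference {a : κ → ℚ} (ha : Function.Injective a) {S : Finset κ}
    {T : Finset ι} {d : ℕ} (hd : d + S.card = T.card + 1) :
    HasLeadingForm (dividedDifference a S T) ((-1) ^ d * esymmOn T d) d := by
  classical
  have hhom : ∀ U : Finset ι, (∏ j ∈ U, X j : MvPolynomial ι ℚ).IsHomogeneous U.card := fun U => by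
    simpa using IsHomogeneous.prod U (fun j => (X j : MvPolynomial ι ℚ)) (fun _ => 1)
      fun j _ => isHomogeneous_X ℚ j
  constructor
  · rw [show (-1 : MvPolynomial ι ℚ) ^ d = C ((-1) ^ d) by simp]
    refine IsHomogeneous.C_mul (IsHomogeneous.sum _ _ _ fun U hU => ?_) _
    rw [← (Finset.mem_powersetCard.mp hU).2]
    exact hhom U
  have h1 : dividedDifference a S T = ∑ U ∈ T.powerset,
      C ((-1) ^ U.card * ∑ l ∈ S, a l ^ (T.card - U.card) / ∏ m ∈ S.erase l, (a l - a m)) *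
        ∏ j ∈ U, X j := by
    simp only [dividedDifference, Finset.prod_sub, Finset.mul_sum]
    rw [Finset.sum_comm]
    refine Finset.sum_congr rfl fun U hU => ?_
    rw [map_sum, Finset.sum_mul]
    refine Finset.sum_congr rfl fun l _ => ?_
    rw [Finset.prod_const, Finset.card_sdiff_of_subset (Finset.mem_powerset.mp hU)]
    simp only [div_eq_mul_inv, map_mul, map_pow, map_neg, map_one]
    ring
  have h2 : (-1) ^ d * esymmOn T d = ∑ U ∈ T.powerset,
      if U.card = d then C ((-1) ^ d) * ∏ j ∈ U, X j else (0 : MvPolynomial ι ℚ) := by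
    rw [← Finset.sum_filter, ← Finset.powersetCard_eq_filter, esymmOn, Finset.mul_sum]
    simp
  rw [h1, h2, ← Finset.sum_sub_distrib]
  refine Submodule.sum_mem _ fun U hU => ?_
  have hU' := Finset.card_le_card (Finset.mem_powerset.mp hU)
  rcases lt_or_ge U.card d with hlt | hge
  · rw [if_neg hlt.ne, sub_zero]
    exact IsHomogeneous.mem_degLT ((hhom U).C_mul _) hlt
  · rw [sum_pow_div_prod_eq ha (by omega)]
    split_ifs <;> first | omega | simp_all

theorem eval_dividedDifference_eq_zero {a : κ → ℚ} {S : Finset κ} {T : Finset ι} {x : ι → ℚ}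
    (h : ∀ l ∈ S, ∃ j ∈ T, x j = a l) : eval x (dividedDifference a S T) = 0 := by
  rw [dividedDifference, map_sum]
  refine Finset.sum_eq_zero fun l hl => ?_
  obtain ⟨j, hj, hjl⟩ := h l hl
  rw [map_mul, map_prod, Finset.prod_eq_zero hj (by simp [hjl]), mul_zero]

end Vanishing

theorem mem_vanishingIdeal_locus {n k : ℕ} {α : Fin n → ℚ} {f : MvPolynomial (Fin n) ℚ}
    (h : ∀ w : PackedWordGE n k, eval (point α w.1 w.2.1) f = 0) :
    f ∈ vanishingIdeal ℚ (locus α k) := by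
  rw [mem_vanishingIdeal_iff]
  rintro _ ⟨w, rfl⟩
  simpa [coe_aeval_eq_eval] using h w

theorem card_filter_lt {n r : ℕ} (h : r ≤ n) :
    (Finset.univ.filter fun l : Fin n => (l : ℕ) < r).card = r := by
  rw [Fin.card_filter_val_lt, min_eq_right h]

/-- The point of a word takes the value `α_l` at the positions of the letter `l + 1`. -/
theorem point_eq {n : ℕ} (α : Fin n → ℚ) {w : Fin n → ℕ+} (hw : IsPacked w) {j l : Fin n}
    (h : w j = Nat.succPNat l) : point α w hw j = α l := by
  unfold point
  congr 1
  ext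
  simp [h]

/-- Use the nodes α_1, …, α_{n+1-d}. Since n + 1 - d ≤ k, each of these letters occurs in every word
of the locus, so every term of the divided difference vanishes there. -/
theorem esymm_mem_assocGradedIdeal {n k d : ℕ} {α : Fin n → ℚ} (hα : Function.Injective α)
    (hkn : k ≤ n) (hd : n + 1 ≤ d + k) (hdn : d ≤ n) :
    esymm (Fin n) ℚ d ∈ assocGradedIdeal (locus α k) := by
  have hr : n + 1 - d ≤ n := by omega
  have hlead := hasLeadingForm_dividedDifference hα
    (S := Finset.univ.filter fun l : Fin n => (l : ℕ) < n + 1 - d) 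
    (T := (Finset.univ : Finset (Fin n))) (d := d)
    (by rw [card_filter_lt hr, Finset.card_univ, Fintype.card_fin]; omega)
  have := hlead.mem_assocGradedIdeal (Y := locus α k)
    (mem_vanishingIdeal_locus fun w => ?_)
  · have := Ideal.mul_mem_left _ ((-1) ^ d) this
    rwa [← mul_assoc, ← mul_pow, neg_one_mul, neg_neg, one_pow, one_mul,
      ← esymm_eq_esymmOn] at this
  · refine eval_dividedDifference_eq_zero fun l hl => ?_
    obtain ⟨j, hj⟩ := w.2.2 (Nat.succPNat l) (by
      have := (Finset.mem_filter.mp hl).2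
      rw [Nat.succPNat_coe]
      omega)
    exact ⟨j, Finset.mem_univ j, point_eq α w.2.1 hj⟩

/-- Multiply ∏_{l ≤ r} (x_i - α_l) by the divided difference at α_1, …, α_r in the other variables.
If w_i ≤ r, the first factor vanishes. If w_i > r, packedness puts all of 1, …, r at positions other
than i, and the second vanishes. -/
theorem gensJ_subset_assocGradedIdeal {n : ℕ} (k : ℕ) {α : Fin n → ℚ}
    (hα : Function.Injective α) : gensJ n ⊆ assocGradedIdeal (locus α k) := by
  rintro _ ⟨i, d, r, h1, h2, h3, rfl⟩
  obtain ⟨e, rfl⟩ := Nat.exists_eq_add_of_le' h2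
  let S := Finset.univ.filter fun l : Fin n => (l : ℕ) < r
  have hS : S.card = r := card_filter_lt h3
  have hlead := (hasLeadingForm_prod_X_sub_C i α S).mul (hasLeadingForm_dividedDifference hα
    (S := S) (T := Finset.univ.erase i) (d := n - r)
    (by rw [hS, Finset.card_erase_of_mem (Finset.mem_univ i), Finset.card_univ,
      Fintype.card_fin]; omega))
  have := hlead.mem_assocGradedIdeal (Y := locus α k) (mem_vanishingIdeal_locus fun w => ?_)
  -- The leading form is ± x_i^r e_{n-r}^{(i)}; the factor x_i^e with e = d - r raises the exponent
  -- to d, and the sign cancels.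
  · have := Ideal.mul_mem_left _ (X i ^ e * (-1) ^ (n - r)) this
    refine (congrArg (· ∈ assocGradedIdeal (locus α k)) ?_).mpr this
    rw [hS, esymmOmit_eq, pow_add]
    have h : ((-1) ^ (n - r) * (-1) ^ (n - r) : MvPolynomial (Fin n) ℚ) = 1 := by
      rw [← mul_pow]; simp
    linear_combination (-(X i ^ e * X i ^ r * esymmOn (Finset.univ.erase i) (n - r))) * h
  · rw [map_mul]
    rcases le_or_gt (w.1 i : ℕ) r with hle | hlt
    · have hi := w.2.1.letter_le i
      have hpos := (w.1 i).pos
      rw [map_prod, Finset.prod_eq_zero (i := ⟨(w.1 i : ℕ) - 1, by omega⟩), zero_mul]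
      · exact Finset.mem_filter.mpr ⟨Finset.mem_univ _, by simp only; omega⟩
      · simp [point]
    · rw [eval_dividedDifference_eq_zero, mul_zero]
      intro l hl
      have hl' := (Finset.mem_filter.mp hl).2
      have hlw : Nat.succPNat l < w.1 i := by
        rw [← PNat.coe_lt_coe, Nat.succPNat_coe]; omega
      obtain ⟨j, hj⟩ := w.2.1.mem_range_of_le (w.1 i) ⟨i, rfl⟩ (Nat.succPNat l) hlw.le
      refine ⟨j, Finset.mem_erase.mpr ⟨?_, Finset.mem_univ j⟩, point_eq α w.2.1 hj⟩
      rintro rfl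
      exact hlw.ne' hj

theorem idealJGE_le_assocGradedIdeal {n k : ℕ} (hkn : k ≤ n) {α : Fin n → ℚ}
    (hα : Function.Injective α) : idealJGE n k ≤ assocGradedIdeal (locus α k) := by
  refine sup_le (Ideal.span_le.mpr (gensJ_subset_assocGradedIdeal k hα)) (Ideal.span_le.mpr ?_)
  rintro _ ⟨d, h1, h2, rfl⟩
  exact esymm_mem_assocGradedIdeal hα hkn h1 h2

/-! ### Equivariant projections -/

/-- Maschke's argument: average an arbitrary linear projection onto F over its conjugates. -/
theorem exists_equivariant_projection {G V : Type*} [Group G] [Finite G] [AddCommGroup V]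
    [Module ℚ V] (ρ : Representation ℚ G V) (F : Submodule ℚ V)
    (hF : ∀ g, ∀ v ∈ F, ρ g v ∈ F) :
    ∃ q : V →ₗ[ℚ] V, (∀ v, q v ∈ F) ∧ (∀ v ∈ F, q v = v) ∧ ∀ g v, q (ρ g v) = ρ g (q v) := by
  have := Fintype.ofFinite G
  obtain ⟨p, hp⟩ := F.subtype.exists_leftInverse_of_injective F.ker_subtype
  have hp' : ∀ v (hv : v ∈ F), (p v : V) = v := fun v hv => by
    have := LinearMap.congr_fun hp ⟨v, hv⟩
    simpa using congrArg Subtype.val this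
  have hinv : ∀ (g : G) v, ρ g (ρ g⁻¹ v) = v := fun g v => by
    rw [← Module.End.mul_apply, ← map_mul, mul_inv_cancel, map_one, Module.End.one_apply]
  refine ⟨(Fintype.card G : ℚ)⁻¹ • ∑ g : G, ρ g ∘ₗ F.subtype ∘ₗ p ∘ₗ ρ g⁻¹, fun v => ?_,
    fun v hv => ?_, fun h v => ?_⟩
  · simp only [LinearMap.smul_apply, LinearMap.sum_apply, LinearMap.comp_apply]
    exact F.smul_mem _ (F.sum_mem fun g _ => hF g _ (Subtype.mem _))
  · simp only [LinearMap.smul_apply, LinearMap.sum_apply, LinearMap.comp_apply,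
      Submodule.subtype_apply]
    rw [Finset.sum_congr rfl fun g _ => by rw [hp' _ (hF g⁻¹ v hv), hinv]]
    rw [Finset.sum_const, Finset.card_univ, ← Nat.cast_smul_eq_nsmul ℚ, smul_smul,
      inv_mul_cancel₀ (by exact_mod_cast Fintype.card_ne_zero), one_smul]
  · simp only [LinearMap.smul_apply, LinearMap.sum_apply, LinearMap.comp_apply, map_smul, map_sum]
    congr 1
    refine Fintype.sum_equiv (Equiv.mulLeft h⁻¹) _ _ fun g => ?_
    simp only [Equiv.coe_mulLeft, mul_inv_rev, inv_inv, map_mul, Module.End.mul_apply, hinv]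

/-! ### Evaluation at a finite set of points -/

section Points

variable {ι W : Type*} [Finite W]

/-- Evaluation of polynomials at the points `pt w`. -/
def evalPoints (pt : W → ι → ℚ) : MvPolynomial ι ℚ →ₗ[ℚ] MonoidAlgebra ℚ W :=
  (MonoidAlgebra.coeffLinearEquiv ℚ).symm.toLinearMap ∘ₗ
    (Finsupp.linearEquivFunOnFinite ℚ ℚ W).symm.toLinearMap ∘ₗ
      LinearMap.pi fun w => (aeval (pt w)).toLinearMap

@[simp]
theorem coeff_evalPoints (pt : W → ι → ℚ) (f : MvPolynomial ι ℚ) (w : W) :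
    (evalPoints pt f).coeff w = eval (pt w) f := by
  simp [evalPoints]

/-- For each other point choose a coordinate in which it differs from `pt w`, and multiply the
resulting linear factors. -/
theorem exists_eval_separating {pt : W → ι → ℚ} (hpt : Function.Injective pt) (w : W) :
    ∃ f : MvPolynomial ι ℚ, eval (pt w) f ≠ 0 ∧ ∀ v ≠ w, eval (pt v) f = 0 := by
  classical
  have := Fintype.ofFinite W
  have h : ∀ v, ∃ l : MvPolynomial ι ℚ, eval (pt v) l = 0 ∧ (v ≠ w → eval (pt w) l ≠ 0) := by
    intro v
    by_cases hv : v = w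
    · exact ⟨0, by simp, fun h => absurd hv h⟩
    · obtain ⟨i, hi⟩ := Function.ne_iff.mp (hpt.ne hv)
      exact ⟨X i - C (pt v i), by simp, fun _ => by simpa [sub_eq_zero] using hi.symm⟩
  choose l hl hl' using h
  refine ⟨∏ v ∈ Finset.univ.erase w, l v, ?_, fun v hv => ?_⟩
  · rw [map_prod, Finset.prod_ne_zero_iff]
    exact fun v hv => hl' v (Finset.ne_of_mem_erase hv)
  · rw [map_prod]
    exact Finset.prod_eq_zero (Finset.mem_erase.mpr ⟨hv, Finset.mem_univ v⟩) (hl v)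

theorem evalPoints_surjective {pt : W → ι → ℚ} (hpt : Function.Injective pt) :
    Function.Surjective (evalPoints pt) := by
  have := Fintype.ofFinite W
  choose f hf hf' using exists_eval_separating hpt
  intro u
  refine ⟨∑ w, (u.coeff w / eval (pt w) (f w)) • f w, ?_⟩
  ext v
  rw [coeff_evalPoints, map_sum, Finset.sum_eq_single v]
  · rw [smul_eval, div_mul_cancel₀ _ (hf v)]
  · intro w _ hw
    rw [smul_eval, hf' w v hw.symm, mul_zero]
  · simp

theorem evalPoints_mul_eq_zero {pt : W → ι → ℚ} {f : MvPolynomial ι ℚ}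
    (hf : f ∈ vanishingIdeal ℚ (Set.range pt)) (g : MvPolynomial ι ℚ) :
    evalPoints pt (g * f) = 0 := by
  ext w
  have := (mem_vanishingIdeal_iff.mp hf) (pt w) ⟨w, rfl⟩
  rw [coeff_evalPoints, map_mul, ← aeval_eq_eval, this, mul_zero]
  rfl

/-- The linear map which is `(1 - q_d) ∘ ev` on the homogeneous polynomials of degree `d`. -/
def gradedEval (pt : W → ι → ℚ) (q : ℕ → MonoidAlgebra ℚ W →ₗ[ℚ] MonoidAlgebra ℚ W) :
    MvPolynomial ι ℚ →ₗ[ℚ] MonoidAlgebra ℚ W :=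
  (basisMonomials ι ℚ).constr ℚ fun m =>
    evalPoints pt (monomial m 1) - q m.degree (evalPoints pt (monomial m 1))

theorem gradedEval_of_isHomogeneous (pt : W → ι → ℚ)
    (q : ℕ → MonoidAlgebra ℚ W →ₗ[ℚ] MonoidAlgebra ℚ W) {f : MvPolynomial ι ℚ} {d : ℕ}
    (hf : f.IsHomogeneous d) :
    gradedEval pt q f = evalPoints pt f - q d (evalPoints pt f) := by
  suffices h : ∀ m ∈ f.support, gradedEval pt q (monomial m (coeff m f)) =
      evalPoints pt (monomial m (coeff m f)) - q d (evalPoints pt (monomial m (coeff m f))) by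
    rw [f.as_sum]
    simp only [map_sum]
    rw [← Finset.sum_sub_distrib]
    exact Finset.sum_congr rfl h
  intro m hm
  have hmd : m.degree = d := by
    by_contra hne
    exact (mem_support_iff.mp hm) (hf.coeff_eq_zero hne)
  have h1 : monomial m (coeff m f) = coeff m f • monomial m (1 : ℚ) := by
    rw [smul_monomial, smul_eq_mul, mul_one]
  have h2 : gradedEval pt q (monomial m 1) =
      evalPoints pt (monomial m 1) - q m.degree (evalPoints pt (monomial m 1)) := by
    have h := (basisMonomials ι ℚ).constr_basis ℚ (fun m =>
      evalPoints pt (monomial m 1) - q m.degree (evalPoints pt (monomial m 1))) m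
    rwa [coe_basisMonomials] at h
  rw [h1, map_smul, map_smul, map_smul, h2, hmd, smul_sub]

variable {pt : W → ι → ℚ} {q : ℕ → MonoidAlgebra ℚ W →ₗ[ℚ] MonoidAlgebra ℚ W}

/-- For f of degree i, ev f = (1 - q_i)(ev f) + q_i(ev f). The second term is a value of a
polynomial of degree below i, so induction on degree applies. -/
theorem range_gradedEval (hq : ∀ d v, q d v ∈ (degLT ι d).map (evalPoints pt)) :
    LinearMap.range (evalPoints pt) ≤ LinearMap.range (gradedEval pt q) := by
  have key : ∀ d, (degLT ι d).map (evalPoints pt) ≤ LinearMap.range (gradedEval pt q) := by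
    intro d
    induction d using Nat.strong_induction_on with
    | _ d ih =>
      rw [degLT, Submodule.map_span, Submodule.span_le]
      rintro _ ⟨f, ⟨i, hi, hf⟩, rfl⟩
      rw [← sub_add_cancel (evalPoints pt f) (q i (evalPoints pt f)),
        ← gradedEval_of_isHomogeneous pt q hf]
      exact Submodule.add_mem _ ⟨f, rfl⟩ (ih i hi (hq i _))
  rintro _ ⟨f, rfl⟩
  exact key _ ⟨f, mem_degLT_totalDegree_succ f, rfl⟩

/-- As f vanishes at the points, r g takes the same values there as -r (f - g), which has smaller
degree. The projection therefore fixes these values, and 1 - q kills them. -/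
theorem HasLeadingForm.gradedEval_mul_eq_zero
    (hq : ∀ d, ∀ v ∈ (degLT ι d).map (evalPoints pt), q d v = v)
    {f g : MvPolynomial ι ℚ} {d : ℕ} (h : HasLeadingForm f g d)
    (hf : f ∈ vanishingIdeal ℚ (Set.range pt)) (p : MvPolynomial ι ℚ) :
    gradedEval pt q (p * g) = 0 := by
  suffices key : ∀ i (r : MvPolynomial ι ℚ), r.IsHomogeneous i → gradedEval pt q (r * g) = 0 by
    rw [← sum_homogeneousComponent p, Finset.sum_mul, map_sum]
    exact Finset.sum_eq_zero fun i _ => key i _ (homogeneousComponent_isHomogeneous i p)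
  intro i r hr
  rw [gradedEval_of_isHomogeneous pt q (hr.mul h.1), hq, sub_self]
  refine ⟨-(r * (f - g)), Submodule.neg_mem _ (mul_mem_degLT hr h.2), ?_⟩
  rw [mul_sub, neg_sub, map_sub, evalPoints_mul_eq_zero hf, sub_zero]

end Points

/-! ### The comparison with the permutation representation -/

section Comparison

variable {n : ℕ} {W : Type*} [Finite W] [MulAction (Equiv.Perm (Fin n)) W]
  {pt : W → Fin n → ℚ}

theorem coeff_ofMulAction {G H : Type*} [Group G] [MulAction G H] (g : G)
    (u : MonoidAlgebra ℚ H) (w : H) :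
    (Representation.ofMulAction ℚ G H g u).coeff w = u.coeff (g⁻¹ • w) := by
  have : Representation.ofMulAction ℚ G H g u =
      (MonoidAlgebra.coeffLinearEquiv ℚ).symm (Finsupp.mapDomain (g • ·) u.coeff) := rfl
  rw [this]
  change Finsupp.mapDomain (g • ·) u.coeff w = _
  conv_lhs => rw [← smul_inv_smul g w]
  exact Finsupp.mapDomain_apply (MulAction.injective g) _ _

theorem evalPoints_rename (hact : ∀ (σ : Equiv.Perm (Fin n)) w, pt (σ⁻¹ • w) = pt w ∘ σ)
    (σ : Equiv.Perm (Fin n)) (f : MvPolynomial (Fin n) ℚ) :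
    evalPoints pt (rename σ f) = Representation.ofMulAction ℚ _ W σ (evalPoints pt f) := by
  ext w
  rw [coeff_ofMulAction, coeff_evalPoints, coeff_evalPoints, eval_rename, hact]

theorem rename_mem_degLT (σ : Equiv.Perm (Fin n)) {d : ℕ} {f : MvPolynomial (Fin n) ℚ}
    (hf : f ∈ degLT (Fin n) d) : rename σ f ∈ degLT (Fin n) d := by
  induction hf using Submodule.span_induction with
  | mem f hf =>
    obtain ⟨i, hi, hf⟩ := hf
    exact IsHomogeneous.mem_degLT hf.rename_isHomogeneous hi
  | zero => simp
  | add f g _ _ hf hg => rw [map_add]; exact Submodule.add_mem _ hf hg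
  | smul a f _ hf => rw [map_smul]; exact Submodule.smul_mem _ a hf

/-- There is an equivariant surjection from the polynomial ring to the permutation representation
on a finite stable set of points which kills the associated graded ideal. -/
theorem exists_equivariant_surjection (hpt : Function.Injective pt)
    (hact : ∀ (σ : Equiv.Perm (Fin n)) w, pt (σ⁻¹ • w) = pt w ∘ σ) :
    ∃ Φ : MvPolynomial (Fin n) ℚ →ₗ[ℚ] MonoidAlgebra ℚ W, Function.Surjective Φ ∧
      (∀ f ∈ assocGradedIdeal (Set.range pt), Φ f = 0) ∧
      ∀ (σ : Equiv.Perm (Fin n)) f,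
        Φ (rename σ f) = Representation.ofMulAction ℚ _ W σ (Φ f) := by
  have hstable : ∀ d (σ : Equiv.Perm (Fin n)), ∀ v ∈ (degLT (Fin n) d).map (evalPoints pt),
      Representation.ofMulAction ℚ _ W σ v ∈ (degLT (Fin n) d).map (evalPoints pt) := by
    rintro d σ _ ⟨f, hf, rfl⟩
    exact ⟨rename σ f, rename_mem_degLT σ hf, evalPoints_rename hact σ f⟩
  choose q hq1 hq2 hq3 using fun d => exists_equivariant_projection _ _ (hstable d)
  refine ⟨gradedEval pt q, ?_, fun f hf => ?_, fun σ f => ?_⟩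
  · rw [← LinearMap.range_eq_top, eq_top_iff, ← LinearMap.range_eq_top.mpr
      (evalPoints_surjective hpt)]
    exact range_gradedEval hq1
  · suffices h : ∀ p, gradedEval pt q (p * f) = 0 by simpa using h 1
    induction hf using Submodule.span_induction with
    | mem f hf =>
      obtain ⟨g, hg, -, rfl⟩ := hf
      exact (hasLeadingForm_homogeneousComponent g).gradedEval_mul_eq_zero hq2 hg
    | zero => simp
    | add f g _ _ hf hg => intro p; rw [mul_add, map_add, hf, hg, add_zero]
    | smul a f _ hf => intro p; rw [smul_eq_mul, ← mul_assoc, hf]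
  · rw [← sum_homogeneousComponent f]
    simp only [map_sum]
    refine Finset.sum_congr rfl fun i _ => ?_
    have h := homogeneousComponent_isHomogeneous i f
    rw [gradedEval_of_isHomogeneous pt q h,
      gradedEval_of_isHomogeneous pt q h.rename_isHomogeneous, evalPoints_rename hact, hq3,
      map_sub]

/-- The surjection onto ℚ[W] descends to the quotient by J, whose dimension is at most |W|, so it is
bijective. The image of T(X) in that quotient maps to zero, hence is zero. -/
theorem equiv_of_le_assocGradedIdeal (hpt : Function.Injective pt)
    (hact : ∀ (σ : Equiv.Perm (Fin n)) w, pt (σ⁻¹ • w) = pt w ∘ σ)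
    {J : Ideal (MvPolynomial (Fin n) ℚ)}
    (hJ : ∀ σ : Equiv.Perm (Fin n), J ≤ J.comap (rename (R := ℚ) σ))
    (hle : J ≤ assocGradedIdeal (Set.range pt)) (hspan : SpansMod J (Nat.card W)) :
    J = assocGradedIdeal (Set.range pt) ∧
      Nonempty ((quotientRep J hJ).Equiv
        (Representation.ofMulAction ℚ (Equiv.Perm (Fin n)) W)) ∧
      Module.Finite ℚ (MvPolynomial (Fin n) ℚ ⧸ J) ∧
      Module.finrank ℚ (MvPolynomial (Fin n) ℚ ⧸ J) = Nat.card W := by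
  obtain ⟨Φ, hsurj, hker, hequiv⟩ := exists_equivariant_surjection hpt hact
  obtain ⟨hfin, hdim⟩ := hspan.finite
  let Ψ : (MvPolynomial (Fin n) ℚ ⧸ J) →ₗ[ℚ] MonoidAlgebra ℚ W :=
    (J.restrictScalars ℚ).liftQ Φ fun f hf => hker f (hle hf)
  have hΨ : ∀ f, Ψ (Ideal.Quotient.mk J f) = Φ f := fun f => rfl
  have hΨsurj : Function.Surjective Ψ := fun u => by
    obtain ⟨f, rfl⟩ := hsurj u
    exact ⟨Ideal.Quotient.mk J f, hΨ f⟩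
  have e := (MonoidAlgebra.coeffLinearEquiv ℚ : MonoidAlgebra ℚ W ≃ₗ[ℚ] (W →₀ ℚ))
  have : Module.Finite ℚ (MonoidAlgebra ℚ W) := Module.Finite.equiv e.symm
  have hW : Module.finrank ℚ (MonoidAlgebra ℚ W) = Nat.card W := by
    have := Fintype.ofFinite W
    rw [e.finrank_eq, Module.finrank_finsupp_self, Nat.card_eq_fintype_card]
  have hdim' : Module.finrank ℚ (MvPolynomial (Fin n) ℚ ⧸ J) = Nat.card W :=
    le_antisymm hdim (hW ▸ LinearMap.finrank_le_finrank_of_surjective hΨsurj)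
  have hΨinj : Function.Injective Ψ :=
    (LinearMap.injective_iff_surjective_of_finrank_eq_finrank (hdim'.trans hW.symm)).mpr hΨsurj
  refine ⟨le_antisymm hle fun f hf => ?_, ⟨?_⟩, hfin, hdim'⟩
  · rw [← Ideal.Quotient.eq_zero_iff_mem]
    apply hΨinj
    rw [hΨ, hker f hf, map_zero]
  · refine Representation.Equiv.mk (LinearEquiv.ofBijective Ψ ⟨hΨinj, hΨsurj⟩) fun σ => ?_
    refine LinearMap.ext fun x => ?_
    obtain ⟨f, rfl⟩ := Ideal.Quotient.mk_surjective x
    exact hequiv σ f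

end Comparison

/-! ### Counting packed words -/

/-- Split off the first letter: if it lies in S, one requirement is erased, otherwise all remain. An
arbitrary S is needed, since erasing a letter does not preserve initial segments. -/
theorem coverCount_eq_card (k n : ℕ) (S : Finset (Fin k)) :
    coverCount k n S.card = Nat.card {f : Fin n → Fin k // ∀ c ∈ S, c ∈ Set.range f} := by
  induction n generalizing S with
  | zero =>
    rcases S.eq_empty_or_nonempty with rfl | ⟨c, hc⟩
    · simp [coverCount]
    · have : IsEmpty {f : Fin 0 → Fin k // ∀ c ∈ S, c ∈ Set.range f} :=
        ⟨fun f => (f.2 c hc).elim fun i _ => i.elim0⟩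
      rw [Nat.card_of_isEmpty, coverCount, if_neg (Finset.card_ne_zero_of_mem hc)]
  | succ n ih =>
    have e : {f : Fin (n + 1) → Fin k // ∀ c ∈ S, c ∈ Set.range f} ≃
        {p : Fin k × (Fin n → Fin k) // ∀ c ∈ S.erase p.1, c ∈ Set.range p.2} :=
      (Fin.consEquiv fun _ => Fin k).symm.subtypeEquiv fun f => by
        simp only [Fin.consEquiv_symm_apply, Finset.mem_erase, Set.mem_range, Fin.exists_fin_succ]
        refine forall_congr' fun c => ?_
        constructor
        · rintro h ⟨h1, h2⟩
          exact (h h2).resolve_left fun h => h1 h.symm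
        · intro h hc
          by_cases h0 : f 0 = c
          · exact Or.inl h0
          · exact Or.inr (h ⟨fun h => h0 h.symm, hc⟩)
    rw [Nat.card_congr e, Nat.card_congr (Equiv.subtypeProdEquivSigmaSubtype
      fun (a : Fin k) (g : Fin n → Fin k) => ∀ c ∈ S.erase a, c ∈ Set.range g), Nat.card_sigma]
    simp only [← ih]
    rw [← Finset.sum_add_sum_compl S, Finset.sum_congr rfl fun c hc => by
      rw [Finset.card_erase_of_mem hc], Finset.sum_congr (s₁ := Sᶜ) rfl fun c hc => by
      rw [Finset.erase_eq_of_notMem (Finset.mem_compl.mp hc)]]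
    simp [coverCount, Finset.card_compl]

instance (n k : ℕ) : Finite (PackedWordGE n k) :=
  Finite.of_injective
    (fun w j => (⟨w.1 j, Nat.lt_succ_of_le (w.2.1.letter_le j)⟩ : Fin (n + 1)))
    fun _ _ h => Subtype.ext <| funext fun j =>
      PNat.eq (Fin.mk.inj_iff.mp (congrFun h j))

/-- The packed word of a surjection onto `{0, …, j - 1}`. -/
def wordOfSurjection {n k j : ℕ} (hj : k ≤ j)
    (f : {f : Fin n → Fin j // ∀ c ∈ Finset.univ, c ∈ Set.range f}) : PackedWordGE n k :=
  ⟨fun i => Nat.succPNat (f.1 i), by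
    have h : ∀ m : ℕ+, (m : ℕ) ≤ j → m ∈ Set.range fun i => Nat.succPNat (f.1 i) := by
      intro m hm
      have hpos := m.pos
      obtain ⟨i, hi⟩ := f.2 ⟨(m : ℕ) - 1, by omega⟩ (Finset.mem_univ _)
      refine ⟨i, PNat.eq ?_⟩
      simp only [hi, Nat.succPNat_coe]
      omega
    refine ⟨?_, fun m hm => h m (hm.trans hj)⟩
    rintro m ⟨i, hi⟩
    have hi := congrArg PNat.val hi
    have := (f.1 i).isLt
    simp only [PNat.val_ofNat, Nat.succPNat_coe, PNat.add_coe] at hi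
    exact h m (by omega)⟩

theorem coe_wordOfSurjection {n k j : ℕ} (hj : k ≤ j)
    (f : {f : Fin n → Fin j // ∀ c ∈ Finset.univ, c ∈ Set.range f}) (i : Fin n) :
    ((wordOfSurjection hj f).1 i : ℕ) = f.1 i + 1 := rfl

theorem le_of_wordOfSurjection_eq {n k j j' : ℕ} (hj : k ≤ j) (hj' : k ≤ j')
    {f : {f : Fin n → Fin j // ∀ c ∈ Finset.univ, c ∈ Set.range f}}
    {f' : {f : Fin n → Fin j' // ∀ c ∈ Finset.univ, c ∈ Set.range f}}
    (h : wordOfSurjection hj f = wordOfSurjection hj' f') : j ≤ j' := by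
  rcases Nat.eq_zero_or_pos j with rfl | hpos
  · exact Nat.zero_le _
  -- At this position the word has its largest letter, j; the other description bounds all letters
  -- by j'.
  · obtain ⟨i, hi⟩ := f.2 ⟨j - 1, by omega⟩ (Finset.mem_univ _)
    have h1 := coe_wordOfSurjection hj f i
    rw [h, coe_wordOfSurjection, hi] at h1
    have := (f'.1 i).isLt
    simp only at h1
    omega

/-- The word determines j as its largest letter and then the surjection, so the summands count
disjoint sets of words. The squeeze needs only this inequality. -/
theorem sum_coverCount_le (n k : ℕ) :
    ∑ j ∈ Finset.Ico k (n + 1), coverCount j n j ≤ Nat.card (PackedWordGE n k) := by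
  have hc : ∀ j, coverCount j n j =
      Nat.card {f : Fin n → Fin j // ∀ c ∈ Finset.univ, c ∈ Set.range f} := fun j => by
    rw [← coverCount_eq_card, Finset.card_univ, Fintype.card_fin]
  rw [Finset.sum_congr rfl fun j _ => hc j, ← Finset.sum_coe_sort, ← Nat.card_sigma]
  refine Nat.card_le_card_of_injective
    (fun p => wordOfSurjection (Finset.mem_Ico.mp p.1.2).1 p.2) ?_
  rintro ⟨⟨j, hj⟩, f⟩ ⟨⟨j', hj'⟩, f'⟩ h
  obtain rfl : j = j' :=
    le_antisymm (le_of_wordOfSurjection_eq _ _ h) (le_of_wordOfSurjection_eq _ _ h.symm)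
  congr 1
  refine Subtype.ext (funext fun i => Fin.ext ?_)
  have := congrArg (fun w : PackedWordGE n k => (w.1 i : ℕ)) h
  simpa only [coe_wordOfSurjection, Nat.add_right_cancel_iff] using this

/-! ### The case `k = 1` and the main theorem -/

theorem point_injective {n : ℕ} {α : Fin n → ℚ} (hα : Function.Injective α) {v w : Fin n → ℕ+}
    {hv : IsPacked v} {hw : IsPacked w} (h : point α v hv = point α w hw) : v = w := by
  funext j
  have h1 := Fin.mk.inj_iff.mp (hα (congrFun h j))
  have h2 := (v j).pos
  have h3 := (w j).pos
  exact PNat.eq (by omega)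

theorem IsPacked.one_mem_range {n : ℕ} (hn : 1 ≤ n) {w : Fin n → ℕ+} (hw : IsPacked w) (i : ℕ+)
    (hi : (i : ℕ) ≤ 1) : i ∈ Set.range w :=
  hw.mem_range_of_le (w ⟨0, hn⟩) ⟨_, rfl⟩ i
    (PNat.coe_le_coe _ _ |>.mp (hi.trans (w ⟨0, hn⟩).pos))

/-- A nonempty packed word contains the letter `1`. -/
def packedWordEquiv {n : ℕ} (hn : 1 ≤ n) : PackedWord n ≃ PackedWordGE n 1 :=
  Equiv.subtypeEquivRight fun _ => ⟨fun hw => ⟨hw, hw.one_mem_range hn⟩, And.left⟩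

/-- The only extra generator is e_n = x_i e_{n-1}^{(i)}, which is the generator of J_n with d = r =
1. -/
theorem idealJ_eq_idealJGE_one {n : ℕ} (hn : 1 ≤ n) : idealJ n = idealJGE n 1 := by
  refine le_antisymm le_sup_left (sup_le le_rfl (Ideal.span_le.mpr ?_))
  rintro _ ⟨d, h1, h2, rfl⟩
  obtain ⟨m, rfl⟩ := Nat.exists_eq_add_of_le' hn
  obtain rfl : d = m + 1 := by omega
  rw [esymm_eq_esymmOn, esymmOn_univ_succ 0, esymmOmit_eq 0 (m + 1),
    esymmOn_of_card_lt (by simp), zero_add, ← pow_one (X 0)]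
  exact Ideal.subset_span ⟨0, 1, 1, le_rfl, le_rfl, hn, rfl⟩

theorem locus_one {n : ℕ} (hn : 1 ≤ n) (α : Fin n → ℚ) :
    locus α 1 = Set.range fun w : PackedWord n => point α w.1 w.2 :=
  ((packedWordEquiv hn).surjective.range_comp _).symm

end PackedWordQuotient

end

open PackedWordQuotient in
theorem mainTheorem2 (n k : ℕ) (hk : 1 ≤ k) (hkn : k ≤ n) :
    (∀ α : Fin n → ℚ, Function.Injective α →
      PackedWordQuotient.idealJGE n k =
        PackedWordQuotient.assocGradedIdeal (PackedWordQuotient.locus α k)) ∧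
    Nonempty ((PackedWordQuotient.repSGE n k).Equiv
      (Representation.ofMulAction ℚ (Equiv.Perm (Fin n)) (PackedWordQuotient.PackedWordGE n k))) ∧
    Nonempty ((PackedWordQuotient.repS n).Equiv
      (Representation.ofMulAction ℚ (Equiv.Perm (Fin n)) (PackedWordQuotient.PackedWord n))) ∧
    Module.Finite ℚ (PackedWordQuotient.RingS n) ∧
    Module.finrank ℚ (PackedWordQuotient.RingS n) =
      Nat.card (PackedWordQuotient.PackedWord n) := by
  have hn : 1 ≤ n := hk.trans hkn
  have hGE := fun (α : Fin n → ℚ) (hα : Function.Injective α) =>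
    equiv_of_le_assocGradedIdeal (pt := fun w : PackedWordGE n k => point α w.1 w.2.1)
      (fun v w h => Subtype.ext (point_injective hα h)) (fun _ _ => rfl) (idealJGE_le_comap n k)
      (idealJGE_le_assocGradedIdeal hkn hα)
      ((spansMod_idealJGE hk (by omega)).mono le_rfl (sum_coverCount_le n k))
  -- The module statements do not mention α, so any distinct parameters will do; these are 0, …, n -
  -- 1.
  have hα : Function.Injective fun i : Fin n => ((i : ℕ) : ℚ) := fun i j h =>
    Fin.ext (Nat.cast_injective h)
  have : Finite (PackedWord n) := Finite.of_equiv _ (packedWordEquiv hn).symm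
  -- Applying the comparison directly to J_n and 𝒲_n means that only the containment and the
  -- codimension bound are transferred from k = 1, not the representations.
  have hS := equiv_of_le_assocGradedIdeal
    (pt := fun w : PackedWord n => point (fun i : Fin n => ((i : ℕ) : ℚ)) w.1 w.2)
    (fun v w h => Subtype.ext (point_injective hα h)) (fun _ _ => rfl) (idealJ_le_comap n)
    (by
      rw [idealJ_eq_idealJGE_one hn, ← locus_one hn]
      exact idealJGE_le_assocGradedIdeal hn hα)
    (by
      rw [idealJ_eq_idealJGE_one hn, Nat.card_congr (packedWordEquiv hn)]
      exact (spansMod_idealJGE le_rfl (by omega)).mono le_rfl (sum_coverCount_le n 1))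
  exact ⟨fun α hα => (hGE α hα).1, (hGE _ hα).2.1, hS.2⟩
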